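/- Let $0<\lambda<1$ and let $d$ be a positive integer. In the supermarket model with $n$ queues, each with a single server, customers arrive in a Poisson process at rate $\lambda n$; each arriving customer chooses a list of $d$ queues uniformly at random with replacement and joins a shortest queue among those chosen (the first such queue in the list if there are ties); customers are served first-come first-served, with independent exponentially distributed service times of mean $1$. Let $X_t=(X_t(1),\dots,X_t(n))$ be the vector of queue lengths at time $t$, a continuous-time Markov chain on $\Omega=(\mathbb{Z}^+)^n$ with right-continuous paths, where $\mathbb{Z}^+=\{0,1,2,\dots\}$. A function $f:\Omega\to\mathbb{R}$ is called Lipschitz if $|f(x)-f(y)|\le\|x-y\|_1$ for all $x,y\in\Omega$. Lemma 4.3. There is a constant $c>0$ (depending only on $\lambda$ and $d$) such that the following holds. Let $n\ge 2$ be an integer, let $f$ be a Lipschitz function on $\Omega$, let $x_0\in\Omega$, and assume that the queue-lengths process $(X_t)$ satisfies $X_0=x_0$ almost surely. Then for all times $t>0$ the random variable $f(X_t)$ is integrable, and for all $u\ge 0$, $$\Pr\bigl(|f(X_t)-\mathbf{E}[f(X_t)]|\ge u\bigr)\le n\,e^{-cu^2/(nt+u)}.$$ -/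

import Mathlib

open MeasureTheory ProbabilityTheory
open scoped NNReal

/-- The vector of queue lengths after an arrival in state `x`, when the arriving customer has the
list `δ` of chosen queues: she joins a shortest queue in the list, and `List.argmin` selects the
first of the shortest queues in the list. (For `d = 0` there is no queue to join.) -/
def supermarketArrive {n d : ℕ} (x : Fin n → ℕ) (δ : Fin d → Fin n) : Fin n → ℕ :=
  match (List.ofFn δ).argmin x with
  | some j => Function.update x j (x j + 1)
  | none => x

/-- The vector of queue lengths after a departure event at queue `j` in state `x`. The subtraction
is truncated: departures from an empty queue are ignored. -/
def supermarketDepart {n : ℕ} (x : Fin n → ℕ) (j : Fin n) : Fin n → ℕ :=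
  Function.update x j (x j - 1)

/-- The generator of the supermarket model with `n` queues, `d` choices and arrival rate `lam * n`:
customers arrive at total rate `lam * n`, each with a uniformly random list of `d` queues (chosen
with replacement); departure events occur at total rate `n`, each at a uniformly random queue
(that is, every nonempty queue loses a customer at rate `1`). -/
noncomputable def supermarketGenerator {n : ℕ} (lam : ℝ) (d : ℕ)
    (φ : (Fin n → ℕ) → ℝ) (x : Fin n → ℕ) : ℝ :=
  lam * n * ((∑ δ : Fin d → Fin n, (φ (supermarketArrive x δ) - φ x)) / (n : ℝ) ^ d)
    + n * ((∑ j : Fin n, (φ (supermarketDepart x j) - φ x)) / (n : ℝ))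

/-- `X` is a queue-lengths process of the supermarket model (with any initial distribution), with
respect to the filtration `ℱ`: it is adapted, has right-continuous paths in the discrete space of
queue-lengths vectors, and solves the martingale problem for the generator. As the jump rates are
bounded, this says exactly that `X` is a continuous-time Markov chain with these jump rates. -/
structure IsQueueLengthsProcess {n : ℕ} (lam : ℝ) (d : ℕ) {Ω : Type*} {m : MeasurableSpace Ω}
    (P : Measure Ω) (ℱ : Filtration ℝ≥0 m) (X : ℝ≥0 → Ω → (Fin n → ℕ)) : Prop where
  adapted : ∀ t, Measurable[ℱ t] (X t)
  rightContinuous : ∀ ω t, ContinuousWithinAt (fun s => X s ω) (Set.Ici t) t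
  martingale : ∀ φ : (Fin n → ℕ) → ℝ, (∃ C : ℝ, ∀ x, |φ x| ≤ C) →
    Martingale (fun (t : ℝ≥0) ω => φ (X t ω)
      - ∫ s in (0 : ℝ)..t, supermarketGenerator lam d φ (X s.toNNReal ω)) ℱ P

/-- A real function of the queue-lengths vector that is Lipschitz with constant `1` for the
`L¹` norm. -/
def IsL1Lipschitz {n : ℕ} (f : (Fin n → ℕ) → ℝ) : Prop :=
  ∀ x y : Fin n → ℕ, |f x - f y| ≤ ∑ j, |(x j : ℝ) - (y j : ℝ)|

open Filter Topology BoundedContinuousFunction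

/-! ### Semigroups with bounded generator -/

section BoundedSemigroup

variable {F : Type*} [NormedAddCommGroup F] [NormedSpace ℝ F]

/-- The semigroup with bounded generator `A`. -/
noncomputable def boundedSemigroup (A : F →L[ℝ] F) (s : ℝ) (f : F) : F :=
  NormedSpace.exp (s • A) f

lemma boundedSemigroup_zero (A : F →L[ℝ] F) (f : F) : boundedSemigroup A 0 f = f := by
  simp [boundedSemigroup]

variable [CompleteSpace F]

lemma hasDerivAt_boundedSemigroup (A : F →L[ℝ] F) (s : ℝ) (f : F) :
    HasDerivAt (fun s => boundedSemigroup A s f) (A (boundedSemigroup A s f)) s :=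
  ((ContinuousLinearMap.apply ℝ F f).hasFDerivAt.comp_hasDerivAt s
    (hasDerivAt_exp_smul_const' A s))

lemma hasDerivAt_boundedSemigroup_sub (A : F →L[ℝ] F) (t s : ℝ) (f : F) :
    HasDerivAt (fun s => boundedSemigroup A (t - s) f)
      (-(A (boundedSemigroup A (t - s) f))) s := by
  have := (hasDerivAt_boundedSemigroup A (t - s) f).scomp s ((hasDerivAt_id s).const_sub t)
  simpa [Function.comp_def] using this

lemma hasSum_boundedSemigroup (A : F →L[ℝ] F) (s : ℝ) (f : F) :
    HasSum (fun k : ℕ => ((k.factorial : ℝ)⁻¹ * s ^ k) • A^[k] f) (boundedSemigroup A s f) := by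
  have h := (ContinuousLinearMap.apply ℝ F f).hasSum
    (NormedSpace.exp_series_hasSum_exp' (𝕂 := ℝ) (s • A))
  refine h.congr_fun fun k => ?_
  simp [smul_pow, smul_smul]

lemma boundedSemigroup_sub_smul_one (A : F →L[ℝ] F) (r s : ℝ) (f : F) :
    boundedSemigroup (A - r • 1) s f = Real.exp (-(s * r)) • boundedSemigroup A s f := by
  let _ : NormedAlgebra ℚ (F →L[ℝ] F) := NormedAlgebra.restrictScalars ℚ ℝ _
  have h : s • (A - r • 1) = algebraMap ℝ (F →L[ℝ] F) (-(s * r)) + s • A := by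
    rw [smul_sub, smul_smul, Algebra.algebraMap_eq_smul_one, neg_smul]
    abel
  rw [boundedSemigroup, h, NormedSpace.exp_add_of_commute (Algebra.commutes _ _),
    ← NormedSpace.algebraMap_exp_comm, ← Real.exp_eq_exp_ℝ, Algebra.algebraMap_eq_smul_one,
    smul_mul_assoc, one_mul]
  rfl

end BoundedSemigroup

/-! ### The forward equation -/

section ForwardEquation

variable {F : Type*} [NormedAddCommGroup F] [NormedSpace ℝ F]

/-- A curve of functionals of norm at most one that solves the forward equation of a bounded
operator in integrated form. -/
structure SolvesForward (A : F →L[ℝ] F) (μ : ℝ → F →L[ℝ] ℝ) : Prop where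
  norm_le : ∀ s φ, |μ s φ| ≤ ‖φ‖
  eq_integral : ∀ a b, 0 ≤ a → a ≤ b → ∀ φ, μ b φ - μ a φ = ∫ r in a..b, μ r (A φ)

variable {A : F →L[ℝ] F} {μ : ℝ → F →L[ℝ] ℝ}

lemma SolvesForward.abs_sub_le (h : SolvesForward A μ) {a b : ℝ} (ha : 0 ≤ a) (hb : 0 ≤ b)
    (φ : F) : |μ b φ - μ a φ| ≤ ‖A φ‖ * |b - a| := by
  wlog hab : a ≤ b generalizing a b
  · rw [abs_sub_comm, abs_sub_comm b]
    exact this hb ha (le_of_not_ge hab)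
  rw [h.eq_integral a b ha hab, ← Real.norm_eq_abs]
  exact intervalIntegral.norm_integral_le_of_norm_le_const fun r _ => h.norm_le r _

lemma SolvesForward.continuousOn (h : SolvesForward A μ) (φ : F) :
    ContinuousOn (fun s => μ s φ) (Set.Ici 0) := by
  refine (LipschitzOnWith.of_dist_le_mul (K := ‖A φ‖₊) fun a ha b hb => ?_).continuousOn
  rw [Real.dist_eq, Real.dist_eq]
  exact h.abs_sub_le hb ha φ

lemma SolvesForward.abs_sub_sub_le (h : SolvesForward A μ) {a b : ℝ} (ha : 0 ≤ a) (hb : 0 ≤ b)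
    (φ : F) : |μ b φ - μ a φ - (b - a) * μ a (A φ)| ≤ ‖A (A φ)‖ * |b - a| ^ 2 := by
  have key : ∀ {a b : ℝ}, 0 ≤ a → a ≤ b → ∀ c ∈ Set.Icc a b,
      |μ b φ - μ a φ - (b - a) * μ c (A φ)| ≤ ‖A (A φ)‖ * |b - a| ^ 2 := by
    intro a b ha hab c hc
    have hint : IntervalIntegrable (fun r => μ r (A φ)) volume a b := by
      refine ContinuousOn.intervalIntegrable ((h.continuousOn (A φ)).mono ?_)
      rw [Set.uIcc_of_le hab]
      exact fun r hr => ha.trans hr.1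
    have e : μ b φ - μ a φ - (b - a) * μ c (A φ)
        = ∫ r in a..b, (μ r (A φ) - μ c (A φ)) := by
      rw [intervalIntegral.integral_sub hint intervalIntegrable_const, h.eq_integral a b ha hab,
        intervalIntegral.integral_const, smul_eq_mul]
    rw [e, ← Real.norm_eq_abs, sq, ← mul_assoc]
    refine intervalIntegral.norm_integral_le_of_norm_le_const fun r hr => ?_
    rw [Set.uIoc_of_le hab] at hr
    refine (h.abs_sub_le (ha.trans hc.1) (ha.trans hr.1.le) (A φ)).trans
      (mul_le_mul_of_nonneg_left ?_ (norm_nonneg _))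
    rw [abs_of_nonneg (sub_nonneg.2 hab), abs_le]
    constructor <;> linarith [hc.1, hc.2, hr.1, hr.2]
  rcases le_total a b with hab | hab
  · exact key ha hab a ⟨le_rfl, hab⟩
  · have := key hb hab a ⟨hab, le_rfl⟩
    rw [abs_sub_comm b a, ← abs_neg]
    convert this using 2
    ring

lemma SolvesForward.opNorm_sub_le (h : SolvesForward A μ) {a b : ℝ} (ha : 0 ≤ a) (hb : 0 ≤ b) :
    ‖μ b - μ a‖ ≤ ‖A‖ * |b - a| := by
  refine ContinuousLinearMap.opNorm_le_bound _ (by positivity) fun φ => ?_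
  calc ‖(μ b - μ a) φ‖ ≤ ‖A φ‖ * |b - a| := h.abs_sub_le ha hb φ
    _ ≤ (‖A‖ * ‖φ‖) * |b - a| := by gcongr; exact A.le_opNorm φ
    _ = ‖A‖ * |b - a| * ‖φ‖ := by ring

lemma SolvesForward.continuousOn_clm (h : SolvesForward A μ) : ContinuousOn μ (Set.Ici 0) := by
  refine (LipschitzOnWith.of_dist_le_mul (K := ‖A‖₊) fun a ha b hb => ?_).continuousOn
  rw [dist_eq_norm, Real.dist_eq]
  exact h.opNorm_sub_le hb ha

lemma SolvesForward.hasDerivAt (h : SolvesForward A μ) {a : ℝ} (ha : 0 < a) :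
    HasDerivAt μ ((μ a).comp A) a := by
  rw [hasDerivAt_iff_isLittleO]
  have h1 : (fun b => μ b - μ a - (b - a) • (μ a).comp A)
      =O[𝓝 a] fun b => (b - a) ^ 2 := by
    refine Asymptotics.IsBigO.of_bound (‖A‖ * ‖A‖) ?_
    filter_upwards [lt_mem_nhds ha] with b hb
    refine ContinuousLinearMap.opNorm_le_bound _ (by positivity) fun φ => ?_
    calc ‖(μ b - μ a - (b - a) • (μ a).comp A) φ‖ ≤ ‖A (A φ)‖ * |b - a| ^ 2 :=
          h.abs_sub_sub_le ha.le hb.le φ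
      _ ≤ (‖A‖ * (‖A‖ * ‖φ‖)) * |b - a| ^ 2 := by
          gcongr; exact (A.le_opNorm _).trans (by gcongr; exact A.le_opNorm φ)
      _ = ‖A‖ * ‖A‖ * ‖(b - a) ^ 2‖ * ‖φ‖ := by
          rw [Real.norm_eq_abs, abs_pow]; ring
  refine h1.trans_isLittleO ?_
  have h2 : Tendsto (fun b : ℝ => b - a) (𝓝 a) (𝓝 0) := by
    have : Tendsto (fun b : ℝ => b - a) (𝓝 a) (𝓝 (a - a)) :=
      (continuous_id.sub continuous_const).tendsto a
    rwa [sub_self] at this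
  have h3 := (Asymptotics.isLittleO_pow_id (𝕜 := ℝ) (n := 2) (by norm_num)).comp_tendsto h2
  exact h3

lemma SolvesForward.hasDerivAt_apply (h : SolvesForward A μ) {a : ℝ} (ha : 0 < a) {G : ℝ → F}
    {G' : F} (hG : HasDerivAt G G' a) :
    HasDerivAt (fun s => μ s (G s)) (μ a (A (G a) + G')) a := by
  have := (h.hasDerivAt ha).clm_apply hG
  rwa [map_add]

lemma SolvesForward.continuousOn_apply (h : SolvesForward A μ) {G : ℝ → F} (hG : Continuous G) :
    ContinuousOn (fun s => μ s (G s)) (Set.Ici 0) :=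
  h.continuousOn_clm.clm_apply hG.continuousOn

variable [CompleteSpace F]

/-- Duality: the forward equation is solved by the adjoint semigroup. -/
lemma SolvesForward.apply_eq (h : SolvesForward A μ) {t : ℝ} (ht : 0 ≤ t) (f : F) :
    μ t f = μ 0 (boundedSemigroup A t f) := by
  have hc : ContinuousOn (fun s => μ s (boundedSemigroup A (t - s) f)) (Set.Icc 0 t) :=
    (h.continuousOn_apply (continuous_iff_continuousAt.2 fun s =>
      (hasDerivAt_boundedSemigroup_sub A t s f).continuousAt)).mono
      fun s hs => hs.1
  rcases ht.eq_or_lt with rfl | ht'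
  · rw [boundedSemigroup_zero]
  obtain ⟨c, hc', hcc⟩ := exists_hasDerivAt_eq_slope _ _ ht' hc
    fun s hs => h.hasDerivAt_apply hs.1 (hasDerivAt_boundedSemigroup_sub A t s f)
  rw [add_neg_cancel, map_zero, eq_comm, div_eq_zero_iff] at hcc
  rcases hcc with hcc | hcc
  · rw [sub_self, boundedSemigroup_zero, sub_zero, sub_eq_zero] at hcc
    exact hcc
  · linarith

end ForwardEquation

/-! ### Bounded jump generators on discrete spaces -/

section JumpGenerator

variable {E ι : Type*} [TopologicalSpace E]

@[simp] lemma boundedContinuousFunction_exp_apply (g : E →ᵇ ℝ) (x : E) :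
    NormedSpace.exp g x = Real.exp (g x) := by
  have h1 := (BoundedContinuousFunction.evalCLM ℝ x).hasSum
    (NormedSpace.exp_series_hasSum_exp' (𝕂 := ℝ) g)
  have h2 := NormedSpace.exp_series_hasSum_exp' (𝕂 := ℝ) (g x)
  rw [Real.exp_eq_exp_ℝ]
  exact h1.unique h2

variable [DiscreteTopology E]

/-- Composition with a self-map of a discrete space, as an operator on bounded functions. -/
noncomputable def pullbackCLM (T : E → E) : (E →ᵇ ℝ) →L[ℝ] (E →ᵇ ℝ) :=
  LinearMap.mkContinuous
    { toFun := fun φ => φ.compContinuous ⟨T, continuous_of_discreteTopology⟩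
      map_add' := fun _ _ => rfl
      map_smul' := fun _ _ => rfl } 1 fun φ => by
    rw [one_mul]
    exact (BoundedContinuousFunction.norm_le (norm_nonneg φ)).2 fun x => φ.norm_coe_le_norm (T x)

@[simp] lemma pullbackCLM_apply (T : E → E) (φ : E →ᵇ ℝ) (x : E) :
    pullbackCLM T φ x = φ (T x) := rfl

variable [Fintype ι]

/-- The weighted sum of the jump operators. -/
noncomputable def jumpOperator (w : ι → ℝ) (T : ι → E → E) : (E →ᵇ ℝ) →L[ℝ] (E →ᵇ ℝ) :=
  ∑ i, w i • pullbackCLM (T i)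

lemma jumpOperator_apply (w : ι → ℝ) (T : ι → E → E) (φ : E →ᵇ ℝ) (x : E) :
    jumpOperator w T φ x = ∑ i, w i * φ (T i x) := by
  simp [jumpOperator, BoundedContinuousFunction.sum_apply]

/-- The generator of the Markov chain that jumps from `x` to `T i x` at rate `w i`. -/
noncomputable def jumpGenerator (w : ι → ℝ) (T : ι → E → E) : (E →ᵇ ℝ) →L[ℝ] (E →ᵇ ℝ) :=
  jumpOperator w T - (∑ i, w i) • 1

lemma jumpGenerator_apply (w : ι → ℝ) (T : ι → E → E) (φ : E →ᵇ ℝ) (x : E) :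
    jumpGenerator w T φ x = ∑ i, w i * (φ (T i x) - φ x) := by
  simp [jumpGenerator, jumpOperator_apply, mul_sub, Finset.sum_mul]

/-- `φ` changes by at most `1` along the relation `R`. -/
def UnitVariation (R : E → E → Prop) (φ : E → ℝ) : Prop :=
  ∀ x y, R x y → |φ x - φ y| ≤ 1

lemma abs_iterate_jumpOperator_sub_le {w : ι → ℝ} (hw : ∀ i, 0 ≤ w i) {T : ι → E → E}
    {R : E → E → Prop} (hT : ∀ i x y, R x y → R (T i x) (T i y)) {f : E →ᵇ ℝ}
    (hf : UnitVariation R f) (k : ℕ) (x y : E) (hxy : R x y) :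
    |(jumpOperator w T)^[k] f x - (jumpOperator w T)^[k] f y| ≤ (∑ i, w i) ^ k := by
  induction k generalizing x y with
  | zero => simpa using hf x y hxy
  | succ k ih =>
    rw [Function.iterate_succ_apply', jumpOperator_apply, jumpOperator_apply,
      ← Finset.sum_sub_distrib, pow_succ', Finset.sum_mul]
    refine (Finset.abs_sum_le_sum_abs _ _).trans (Finset.sum_le_sum fun i _ => ?_)
    rw [← mul_sub, abs_mul, abs_of_nonneg (hw i)]
    exact mul_le_mul_of_nonneg_left (ih _ _ (hT i x y hxy)) (hw i)

/-- The semigroup of a jump generator whose jump maps preserve `R` does not increase the variation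
of a function along `R`. -/
lemma unitVariation_boundedSemigroup {w : ι → ℝ} (hw : ∀ i, 0 ≤ w i) {T : ι → E → E}
    {R : E → E → Prop} (hT : ∀ i x y, R x y → R (T i x) (T i y)) {f : E →ᵇ ℝ}
    (hf : UnitVariation R f) {s : ℝ} (hs : 0 ≤ s) :
    UnitVariation R ⇑(boundedSemigroup (jumpGenerator w T) s f) := by
  intro x y hxy
  have h2 : HasSum (fun k : ℕ => ((k.factorial : ℝ)⁻¹ * s ^ k) *
      ((jumpOperator w T)^[k] f x - (jumpOperator w T)^[k] f y))
      (boundedSemigroup (jumpOperator w T) s f x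
        - boundedSemigroup (jumpOperator w T) s f y) := by
    have h := hasSum_boundedSemigroup (jumpOperator w T) s f
    have hx := (BoundedContinuousFunction.evalCLM ℝ x).hasSum h
    have hy := (BoundedContinuousFunction.evalCLM ℝ y).hasSum h
    refine (hx.sub hy).congr_fun fun k => ?_
    exact mul_sub _ _ _
  have h3 := NormedSpace.exp_series_hasSum_exp' (𝕂 := ℝ) (s * ∑ i, w i)
  rw [← Real.exp_eq_exp_ℝ] at h3
  have h4 : |boundedSemigroup (jumpOperator w T) s f x
        - boundedSemigroup (jumpOperator w T) s f y| ≤ Real.exp (s * ∑ i, w i) := by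
    rw [← Real.norm_eq_abs]
    refine HasSum.norm_le_of_bounded h2 h3 fun k => ?_
    rw [norm_mul, Real.norm_eq_abs, Real.norm_eq_abs, abs_of_nonneg (by positivity), mul_pow,
      smul_eq_mul, ← mul_assoc]
    exact mul_le_mul_of_nonneg_left (abs_iterate_jumpOperator_sub_le hw hT hf k x y hxy)
      (by positivity)
  have h5 : ∀ z, boundedSemigroup (jumpGenerator w T) s f z
      = Real.exp (-(s * ∑ i, w i)) * boundedSemigroup (jumpOperator w T) s f z :=
    fun z => DFunLike.congr_fun (boundedSemigroup_sub_smul_one (jumpOperator w T) _ s f) z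
  rw [h5, h5, ← mul_sub, abs_mul, abs_of_pos (Real.exp_pos _), Real.exp_neg,
    inv_mul_le_iff₀ (Real.exp_pos _), mul_one]
  exact h4

/-- The second-order bound for the generator on exponentials of functions with jumps at
most `1`. -/
lemma jumpGenerator_exp_sub_le {w : ι → ℝ} (hw : ∀ i, 0 ≤ w i) {T : ι → E → E} {v : E →ᵇ ℝ}
    (hv : ∀ i x, |v (T i x) - v x| ≤ 1) {θ : ℝ} (hθ : |θ| ≤ 1) (x : E) :
    jumpGenerator w T (NormedSpace.exp (θ • v)) x
        - Real.exp (θ * v x) * (θ * jumpGenerator w T v x)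
      ≤ (∑ i, w i) * θ ^ 2 * Real.exp (θ * v x) := by
  rw [jumpGenerator_apply, jumpGenerator_apply, Finset.mul_sum, Finset.mul_sum,
    ← Finset.sum_sub_distrib, Finset.sum_mul, Finset.sum_mul]
  refine Finset.sum_le_sum fun i _ => ?_
  have h1 : |θ * (v (T i x) - v x)| ≤ |θ| := by
    rw [abs_mul]; exact mul_le_of_le_one_right (abs_nonneg _) (hv i x)
  have h2 := (le_abs_self _).trans (Real.abs_exp_sub_one_sub_id_le (h1.trans hθ))
  have h3 : (θ * (v (T i x) - v x)) ^ 2 ≤ θ ^ 2 := sq_le_sq.2 h1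
  have h4 : Real.exp (θ * v (T i x)) = Real.exp (θ * v x) * Real.exp (θ * (v (T i x) - v x)) := by
    rw [← Real.exp_add]; congr 1; ring
  simp only [boundedContinuousFunction_exp_apply, BoundedContinuousFunction.smul_apply,
    smul_eq_mul, h4]
  have h5 := mul_le_mul_of_nonneg_left (h2.trans h3)
    (mul_nonneg (hw i) (Real.exp_pos (θ * v x)).le)
  linarith

/-- Exponential moment bound for a bounded function whose variation along the jumps is at
most `1`. -/
lemma SolvesForward.apply_exp_le {w : ι → ℝ} (hw : ∀ i, 0 ≤ w i) {T : ι → E → E}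
    {R : E → E → Prop} (hT : ∀ i x y, R x y → R (T i x) (T i y))
    (hR : ∀ i x, R (T i x) x ∨ R x (T i x)) {μ : ℝ → (E →ᵇ ℝ) →L[ℝ] ℝ}
    (hμ : SolvesForward (jumpGenerator w T) μ)
    (hmono : ∀ s (g h : E →ᵇ ℝ), (∀ x, g x ≤ h x) → μ s g ≤ μ s h)
    {f : E →ᵇ ℝ} (hf : UnitVariation R f) {t : ℝ} (ht : 0 ≤ t) {θ : ℝ} (hθ : |θ| ≤ 1) :
    μ t (NormedSpace.exp (θ • f)) ≤ Real.exp ((∑ i, w i) * θ ^ 2 * t)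
      * μ 0 (NormedSpace.exp (θ • boundedSemigroup (jumpGenerator w T) t f)) := by
  set L := jumpGenerator w T with hL
  set K := (∑ i, w i) * θ ^ 2 with hK
  let v : ℝ → (E →ᵇ ℝ) := fun s => boundedSemigroup L (t - s) f
  let G : ℝ → (E →ᵇ ℝ) := fun s => NormedSpace.exp (θ • v s)
  have hG : ∀ s, HasDerivAt G (NormedSpace.exp (θ • v s) * (θ • -(L (v s)))) s := fun s => by
    have h1 : HasDerivAt (fun s => θ • v s) (θ • -(L (v s))) s :=
      (hasDerivAt_boundedSemigroup_sub L t s f).const_smul θ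
    exact (hasStrictFDerivAt_exp (𝕂 := ℝ) (x := θ • v s)).hasFDerivAt.comp_hasDerivAt s h1
  have hGc : Continuous G := continuous_iff_continuousAt.2 fun s => (hG s).continuousAt
  have hH : ∀ s, 0 < s → HasDerivAt (fun s => Real.exp (-(K * s)) * μ s (G s))
      (Real.exp (-(K * s)) * (-K) * μ s (G s) + Real.exp (-(K * s)) *
        μ s (L (G s) + NormedSpace.exp (θ • v s) * (θ • -(L (v s))))) s := fun s hs => by
    have h1 : HasDerivAt (fun s => -(K * s)) (-K) s := by
      have := ((hasDerivAt_id s).const_mul K).neg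
      rwa [mul_one] at this
    exact h1.exp.mul (hμ.hasDerivAt_apply hs (hG s))
  have hHc : ContinuousOn (fun s => Real.exp (-(K * s)) * μ s (G s)) (Set.Icc 0 t) := by
    refine ContinuousOn.mul (by fun_prop) ((hμ.continuousOn_apply hGc).mono fun s hs => hs.1)
  have hanti : AntitoneOn (fun s => Real.exp (-(K * s)) * μ s (G s)) (Set.Icc 0 t) := by
    refine antitoneOn_of_deriv_nonpos (convex_Icc 0 t) hHc ?_ ?_
    · rw [interior_Icc]
      exact fun s hs => (hH s hs.1).differentiableAt.differentiableWithinAt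
    · rw [interior_Icc]
      intro s hs
      rw [(hH s hs.1).deriv]
      have hle : μ s (L (G s) + NormedSpace.exp (θ • v s) * (θ • -(L (v s))))
          ≤ μ s (K • G s) := by
        refine hmono s _ _ fun x => ?_
        have hv : UnitVariation R (v s) := unitVariation_boundedSemigroup hw hT hf (sub_nonneg.2 hs.2.le)
        have hv' : ∀ i x, |v s (T i x) - v s x| ≤ 1 := fun i x => by
          rcases hR i x with h | h
          · exact hv _ _ h
          · rw [abs_sub_comm]; exact hv _ _ h
        have := jumpGenerator_exp_sub_le hw hv' hθ x
        simp only [BoundedContinuousFunction.add_apply, BoundedContinuousFunction.mul_apply,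
          BoundedContinuousFunction.smul_apply, BoundedContinuousFunction.neg_apply,
          boundedContinuousFunction_exp_apply, smul_eq_mul, G]
        linarith
      rw [map_smul, smul_eq_mul] at hle
      have := mul_le_mul_of_nonneg_left hle (Real.exp_pos (-(K * s))).le
      linarith
  have h := hanti ⟨le_rfl, ht⟩ ⟨ht, le_rfl⟩ ht
  simp only [G, v, sub_self, sub_zero, boundedSemigroup_zero, mul_zero, neg_zero, Real.exp_zero,
    one_mul] at h
  rw [Real.exp_neg, inv_mul_le_iff₀ (Real.exp_pos _)] at h
  exact h

end JumpGenerator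

/-! ### Right-continuous processes in a discrete space -/

section RightContinuousProcess

variable {Ω E : Type*} [TopologicalSpace E] [DiscreteTopology E] [MeasurableSpace E]
  [DiscreteMeasurableSpace E] {m : MeasurableSpace Ω}

omit [DiscreteTopology E] in
lemma integrable_boundedContinuousFunction_comp (P : Measure Ω) [IsFiniteMeasure P] {Y : Ω → E}
    (hY : Measurable Y) (φ : E →ᵇ ℝ) : Integrable (fun ω => φ (Y ω)) P :=
  Integrable.of_bound ((Measurable.of_discrete (f := φ)).comp hY).aestronglyMeasurable ‖φ‖
    (ae_of_all _ fun ω => φ.norm_coe_le_norm (Y ω))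

/-- The law of `Y`, as a functional on bounded functions. -/
noncomputable def lawCLM (P : Measure Ω) [IsProbabilityMeasure P] {Y : Ω → E}
    (hY : Measurable Y) : (E →ᵇ ℝ) →L[ℝ] ℝ :=
  LinearMap.mkContinuous
    { toFun := fun φ => ∫ ω, φ (Y ω) ∂P
      map_add' := fun φ ψ => integral_add (integrable_boundedContinuousFunction_comp P hY φ)
        (integrable_boundedContinuousFunction_comp P hY ψ)
      map_smul' := fun c φ => integral_const_mul c _ } 1 fun φ => by
    have h := norm_integral_le_of_norm_le_const (μ := P)
      (ae_of_all _ fun ω => φ.norm_coe_le_norm (Y ω))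
    rw [probReal_univ, mul_one] at h
    rw [one_mul]
    exact h

omit [DiscreteTopology E] in
lemma lawCLM_apply (P : Measure Ω) [IsProbabilityMeasure P] {Y : Ω → E} (hY : Measurable Y)
    (φ : E →ᵇ ℝ) : lawCLM P hY φ = ∫ ω, φ (Y ω) ∂P := rfl

omit [DiscreteTopology E] in
lemma lawCLM_mono (P : Measure Ω) [IsProbabilityMeasure P] {Y : Ω → E} (hY : Measurable Y)
    {g h : E →ᵇ ℝ} (hgh : ∀ x, g x ≤ h x) : lawCLM P hY g ≤ lawCLM P hY h :=
  integral_mono (integrable_boundedContinuousFunction_comp P hY g)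
    (integrable_boundedContinuousFunction_comp P hY h) fun ω => hgh (Y ω)

lemma tendsto_floor_add_one_div (r : ℝ≥0) :
    Tendsto (fun k : ℕ => ((⌊((k : ℝ≥0) + 1) * r⌋₊ : ℝ≥0) + 1) / ((k : ℝ≥0) + 1)) atTop
      (𝓝[≥] r) := by
  have hle : ∀ k : ℕ, r ≤ ((⌊((k : ℝ≥0) + 1) * r⌋₊ : ℝ≥0) + 1) / ((k : ℝ≥0) + 1) := fun k => by
    rw [le_div_iff₀ (by positivity), mul_comm]
    exact (Nat.lt_floor_add_one _).le
  refine tendsto_nhdsWithin_iff.2 ⟨?_, Eventually.of_forall hle⟩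
  have hlim : Tendsto (fun k : ℕ => r + 1 / ((k : ℝ≥0) + 1)) atTop (𝓝 (r + 0)) :=
    tendsto_const_nhds.add tendsto_one_div_add_atTop_nhds_zero_nat
  rw [add_zero] at hlim
  refine tendsto_of_tendsto_of_tendsto_of_le_of_le tendsto_const_nhds hlim hle fun k => ?_
  rw [div_le_iff₀ (by positivity), add_mul r, div_mul_cancel₀ _ (by positivity), mul_comm r]
  gcongr
  exact Nat.floor_le (by positivity)

omit [TopologicalSpace E] [DiscreteTopology E] in
lemma measurable_comp_sampled {X : ℝ≥0 → Ω → E} (hX : ∀ t, Measurable (X t)) (φ : E → ℝ)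
    {N : ℝ → ℕ} (hN : Measurable N) (b : ℕ → ℝ≥0) :
    Measurable fun p : ℝ × Ω => φ (X (b (N p.1)) p.2) := by
  have h1 : Measurable fun q : ℕ × Ω => φ (X (b q.1) q.2) :=
    measurable_from_prod_countable_right fun j => (Measurable.of_discrete (f := φ)).comp (hX (b j))
  exact h1.comp ((hN.comp measurable_fst).prodMk measurable_snd)

lemma measurable_uncurry_of_rightContinuous {X : ℝ≥0 → Ω → E} (hX : ∀ t, Measurable (X t))
    (hc : ∀ ω t, ContinuousWithinAt (fun s => X s ω) (Set.Ici t) t) (φ : E → ℝ) :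
    Measurable fun p : ℝ × Ω => φ (X p.1.toNNReal p.2) := by
  have hφ : Continuous φ := continuous_of_discreteTopology
  let a : ℕ → ℝ≥0 → ℝ≥0 := fun k r => ((⌊((k : ℝ≥0) + 1) * r⌋₊ : ℝ≥0) + 1) / ((k : ℝ≥0) + 1)
  refine measurable_of_tendsto_metrizable (f := fun (k : ℕ) (p : ℝ × Ω) =>
    φ (X (a k p.1.toNNReal) p.2)) (fun k => ?_) (tendsto_pi_nhds.2 fun p => ?_)
  · exact measurable_comp_sampled hX φ
      (N := fun r : ℝ => ⌊((k : ℝ≥0) + 1) * r.toNNReal⌋₊)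
      (Nat.measurable_floor.comp (measurable_real_toNNReal.const_mul _))
      fun j => ((j : ℝ≥0) + 1) / ((k : ℝ≥0) + 1)
  · have h : Tendsto (fun k => X (a k p.1.toNNReal) p.2) atTop (𝓝 (X p.1.toNNReal p.2)) :=
      Tendsto.comp (g := fun s => X s p.2) (hc p.2 p.1.toNNReal)
        (tendsto_floor_add_one_div p.1.toNNReal)
    exact (hφ.tendsto (X p.1.toNNReal p.2)).comp h

lemma solvesForward_lawCLM {P : Measure Ω} [IsProbabilityMeasure P] {ℱ : Filtration ℝ≥0 m}
    {L : (E →ᵇ ℝ) →L[ℝ] (E →ᵇ ℝ)} {X : ℝ≥0 → Ω → E} (hX : ∀ t, Measurable (X t))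
    (hc : ∀ ω t, ContinuousWithinAt (fun s => X s ω) (Set.Ici t) t)
    (hM : ∀ φ : E →ᵇ ℝ, Martingale (fun (t : ℝ≥0) ω => φ (X t ω)
      - ∫ s in (0 : ℝ)..t, L φ (X s.toNNReal ω)) ℱ P) :
    SolvesForward L fun s => lawCLM P (hX s.toNNReal) where
  norm_le s φ := by
    have h := norm_integral_le_of_norm_le_const (μ := P)
      (ae_of_all _ fun ω => φ.norm_coe_le_norm (X s.toNNReal ω))
    rwa [probReal_univ, mul_one] at h
  eq_integral a b ha hab φ := by
    lift a to ℝ≥0 using ha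
    lift b to ℝ≥0 using a.2.trans hab
    have hab' : a ≤ b := by exact_mod_cast hab
    simp only [lawCLM_apply, Real.toNNReal_coe]
    set g : ℝ → Ω → ℝ := fun s ω => L φ (X s.toNNReal ω) with hg
    have hgm : Measurable (Function.uncurry g) := measurable_uncurry_of_rightContinuous hX hc _
    have hgb : ∀ s ω, ‖g s ω‖ ≤ ‖L φ‖ := fun s ω => (L φ).norm_coe_le_norm _
    have hgi : ∀ ω (c d : ℝ), IntervalIntegrable (fun s => g s ω) volume c d := fun ω c d =>
      (intervalIntegrable_const (c := ‖L φ‖)).mono_fun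
        (hgm.comp (measurable_id.prodMk measurable_const)).aestronglyMeasurable
        (ae_of_all _ fun s => by
          rw [Real.norm_of_nonneg (norm_nonneg (L φ))]; exact hgb s ω)
    have hφi := fun t => integrable_boundedContinuousFunction_comp P (hX t) φ
    have hAi : ∀ t : ℝ≥0, Integrable (fun ω => ∫ s in (0 : ℝ)..t, g s ω) P := fun t => by
      have h := (hφi t).sub ((hM φ).integrable t)
      refine h.congr (ae_of_all _ fun ω => ?_)
      simp [hg]
    have hE : ∀ t : ℝ≥0, ∫ ω, (φ (X t ω) - ∫ s in (0 : ℝ)..t, g s ω) ∂P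
        = ∫ ω, φ (X t ω) ∂P - ∫ ω, (∫ s in (0 : ℝ)..t, g s ω) ∂P := fun t =>
      integral_sub (hφi t) (hAi t)
    have hmart : ∫ ω, (φ (X b ω) - ∫ s in (0 : ℝ)..b, g s ω) ∂P
        = ∫ ω, (φ (X a ω) - ∫ s in (0 : ℝ)..a, g s ω) ∂P := by
      rw [← integral_condExp (ℱ.le a)]
      exact integral_congr_ae ((hM φ).2 a b hab')
    rw [hE, hE] at hmart
    have hint : Integrable (Function.uncurry g)
        ((volume.restrict (Set.uIoc (a : ℝ) b)).prod P) := by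
      have : IsFiniteMeasure (volume.restrict (Set.uIoc (a : ℝ) b)) :=
        ⟨by rw [Measure.restrict_apply_univ, Set.uIoc]; exact measure_Ioc_lt_top⟩
      exact Integrable.of_bound hgm.aestronglyMeasurable ‖L φ‖ (ae_of_all _ fun p => hgb p.1 p.2)
    rw [intervalIntegral_integral_swap hint]
    have : ∫ ω, (∫ s in (a : ℝ)..b, g s ω) ∂P
        = ∫ ω, (∫ s in (0 : ℝ)..b, g s ω) ∂P - ∫ ω, (∫ s in (0 : ℝ)..a, g s ω) ∂P := by
      rw [← integral_sub (hAi b) (hAi a)]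
      refine integral_congr_ae (ae_of_all _ fun ω => ?_)
      exact (intervalIntegral.integral_interval_sub_left (hgi ω _ _) (hgi ω _ _)).symm
    rw [this]
    linarith

end RightContinuousProcess

/-! ### Concentration for functions of unit variation -/

/-- A form of Fatou's lemma for nonnegative integrable functions. -/
lemma integrable_and_integral_le_of_tendsto {Ω : Type*} {m : MeasurableSpace Ω} {P : Measure Ω}
    {Y : ℕ → Ω → ℝ} {Z : Ω → ℝ} {C : ℝ} (hY : ∀ k, Integrable (Y k) P)
    (hYm : ∀ k, Measurable (Y k)) (hZm : Measurable Z) (h0 : ∀ k ω, 0 ≤ Y k ω)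
    (hC : ∀ k, ∫ ω, Y k ω ∂P ≤ C) (hlim : ∀ ω, Tendsto (fun k => Y k ω) atTop (𝓝 (Z ω))) :
    Integrable Z P ∧ ∫ ω, Z ω ∂P ≤ C := by
  have hZ0 : ∀ ω, 0 ≤ Z ω := fun ω => ge_of_tendsto' (hlim ω) fun k => h0 k ω
  have hC0 : 0 ≤ C := (integral_nonneg (h0 0)).trans (hC 0)
  have hle : ∫⁻ ω, ENNReal.ofReal (Z ω) ∂P ≤ ENNReal.ofReal C := by
    have e : ∀ ω, ENNReal.ofReal (Z ω) = liminf (fun k => ENNReal.ofReal (Y k ω)) atTop :=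
      fun ω => ((ENNReal.continuous_ofReal.tendsto _).comp (hlim ω)).liminf_eq.symm
    simp_rw [e]
    refine (lintegral_liminf_le fun k => (hYm k).ennreal_ofReal).trans ?_
    refine liminf_le_of_frequently_le' (Frequently.of_forall fun k => ?_)
    rw [← ofReal_integral_eq_lintegral_ofReal (hY k) (ae_of_all _ (h0 k))]
    exact ENNReal.ofReal_le_ofReal (hC k)
  have hint : Integrable Z P := by
    refine ⟨hZm.aestronglyMeasurable, ?_⟩
    rw [hasFiniteIntegral_iff_ofReal (ae_of_all _ hZ0)]
    exact hle.trans_lt ENNReal.ofReal_lt_top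
  refine ⟨hint, ?_⟩
  rw [← ENNReal.ofReal_le_ofReal_iff hC0,
    ofReal_integral_eq_lintegral_ofReal hint (ae_of_all _ hZ0)]
  exact hle

section Concentration

variable {E ι : Type*} [TopologicalSpace E] [DiscreteTopology E]

/-- Truncation of a function to `[-k, k]`. -/
noncomputable def clampBCF (f : E → ℝ) (k : ℕ) : E →ᵇ ℝ :=
  BoundedContinuousFunction.ofNormedAddCommGroupDiscrete (fun x => max (-k : ℝ) (min (f x) k)) k
    fun x => by
      rw [Real.norm_eq_abs, abs_le]
      have : (0 : ℝ) ≤ k := k.cast_nonneg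
      exact ⟨le_max_left _ _, max_le (by linarith) (min_le_right _ _)⟩

lemma clampBCF_apply (f : E → ℝ) (k : ℕ) (x : E) :
    clampBCF f k x = max (-k : ℝ) (min (f x) k) := rfl

lemma abs_clampBCF_le (f : E → ℝ) (k : ℕ) (x : E) : |clampBCF f k x| ≤ |f x| := by
  have : (0 : ℝ) ≤ k := k.cast_nonneg
  rw [clampBCF_apply, abs_le]
  refine ⟨?_, max_le ?_ ((min_le_left _ _).trans (le_abs_self _))⟩
  · refine (le_max_right _ _).trans' (le_min (neg_abs_le _) ?_)
    linarith [abs_nonneg (f x)]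
  · linarith [abs_nonneg (f x)]

lemma tendsto_clampBCF (f : E → ℝ) (x : E) :
    Tendsto (fun k => clampBCF f k x) atTop (𝓝 (f x)) := by
  refine tendsto_const_nhds.congr' ?_
  filter_upwards [eventually_ge_atTop ⌈|f x|⌉₊] with k hk
  have h := abs_le.1 ((Nat.le_ceil _).trans (Nat.cast_le.2 hk) : |f x| ≤ (k : ℝ))
  rw [clampBCF_apply, min_eq_left h.2, max_eq_right h.1]

omit [TopologicalSpace E] [DiscreteTopology E] in
lemma UnitVariation.abs {R : E → E → Prop} {f : E → ℝ} (hf : UnitVariation R f) :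
    UnitVariation R fun x => |f x| :=
  fun x y h => (abs_abs_sub_abs_le _ _).trans (hf x y h)

lemma UnitVariation.clamp {R : E → E → Prop} {f : E → ℝ} (hf : UnitVariation R f) (k : ℕ) :
    UnitVariation R ⇑(clampBCF f k) := by
  intro x y h
  rw [clampBCF_apply, clampBCF_apply]
  refine (abs_max_sub_max_le_max _ _ _ _).trans ?_
  rw [sub_self, abs_zero]
  refine max_le zero_le_one ((abs_min_sub_min_le_max _ _ _ _).trans ?_)
  rw [sub_self, abs_zero]
  exact max_le (hf x y h) zero_le_one

variable [Fintype ι] [MeasurableSpace E] [DiscreteMeasurableSpace E] {Ω : Type*}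
  {m : MeasurableSpace Ω} {P : Measure Ω} [IsProbabilityMeasure P]
  {w : ι → ℝ} {T : ι → E → E} {R : E → E → Prop} {X : ℝ≥0 → Ω → E}

lemma integral_boundedContinuousFunction_le (hw : ∀ i, 0 ≤ w i)
    (hR : ∀ i x, R (T i x) x ∨ R x (T i x)) (hX : ∀ t, Measurable (X t))
    (hμ : SolvesForward (jumpGenerator w T) fun s => lawCLM P (hX s.toNNReal)) {x₀ : E}
    (hx₀ : ∀ᵐ ω ∂P, X 0 ω = x₀) {g : E →ᵇ ℝ} (hg : UnitVariation R g) (t : ℝ≥0) :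
    ∫ ω, g (X t ω) ∂P ≤ g x₀ + (∑ i, w i) * t := by
  have h := hμ.eq_integral 0 t le_rfl t.2 g
  have h0 : lawCLM P (hX (0 : ℝ).toNNReal) g = g x₀ := by
    rw [lawCLM_apply, Real.toNNReal_zero]
    rw [integral_congr_ae (g := fun _ => g x₀) (hx₀.mono fun ω h => by simp only [h])]
    simp
  have hL : ‖jumpGenerator w T g‖ ≤ ∑ i, w i := by
    refine (BoundedContinuousFunction.norm_le (Finset.sum_nonneg fun i _ => hw i)).2 fun x => ?_
    rw [jumpGenerator_apply, Real.norm_eq_abs]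
    refine (Finset.abs_sum_le_sum_abs _ _).trans (Finset.sum_le_sum fun i _ => ?_)
    rw [abs_mul, abs_of_nonneg (hw i)]
    refine mul_le_of_le_one_right (hw i) ?_
    rcases hR i x with h | h
    · exact hg _ _ h
    · rw [abs_sub_comm]; exact hg _ _ h
  have h1 := (le_abs_self _).trans (hμ.abs_sub_le le_rfl t.2 g)
  rw [h0, lawCLM_apply, sub_zero, abs_of_nonneg t.2] at h1
  simp only [NNReal.val_eq_coe, Real.toNNReal_coe] at h1
  have := mul_le_mul_of_nonneg_right hL t.2
  simp only [NNReal.val_eq_coe] at this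
  linarith

lemma integral_exp_boundedContinuousFunction_le (hw : ∀ i, 0 ≤ w i)
    (hT : ∀ i x y, R x y → R (T i x) (T i y))
    (hR : ∀ i x, R (T i x) x ∨ R x (T i x)) (hX : ∀ t, Measurable (X t))
    (hμ : SolvesForward (jumpGenerator w T) fun s => lawCLM P (hX s.toNNReal)) {x₀ : E}
    (hx₀ : ∀ᵐ ω ∂P, X 0 ω = x₀) {g : E →ᵇ ℝ} (hg : UnitVariation R g) (t : ℝ≥0)
    {θ : ℝ} (hθ : |θ| ≤ 1) :
    ∫ ω, Real.exp (θ * (g (X t ω) - ∫ ω', g (X t ω') ∂P)) ∂P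
      ≤ Real.exp ((∑ i, w i) * θ ^ 2 * t) := by
  have h0 : ∀ φ : E →ᵇ ℝ, lawCLM P (hX (0 : ℝ).toNNReal) φ = φ x₀ := fun φ => by
    rw [lawCLM_apply, Real.toNNReal_zero]
    rw [integral_congr_ae (g := fun _ => φ x₀) (hx₀.mono fun ω h => by simp only [h])]
    simp
  have h1 := hμ.apply_eq t.2 g
  have h2 := hμ.apply_exp_le hw hT hR (fun s g h hgh => lawCLM_mono P _ hgh) hg t.2 hθ
  rw [h0] at h1 h2
  simp only [lawCLM_apply, NNReal.val_eq_coe, Real.toNNReal_coe] at h1 h2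
  simp only [boundedContinuousFunction_exp_apply, BoundedContinuousFunction.smul_apply,
    smul_eq_mul] at h2
  rw [← h1] at h2
  simp_rw [mul_sub, Real.exp_sub]
  rw [integral_div, div_le_iff₀ (Real.exp_pos _)]
  exact h2

/-- Integrability of functions of unit variation, and the exponential moment bound. -/
lemma UnitVariation.integrable_and_integral_exp_le (hw : ∀ i, 0 ≤ w i)
    (hT : ∀ i x y, R x y → R (T i x) (T i y))
    (hR : ∀ i x, R (T i x) x ∨ R x (T i x)) (hX : ∀ t, Measurable (X t))
    (hμ : SolvesForward (jumpGenerator w T) fun s => lawCLM P (hX s.toNNReal)) {x₀ : E}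
    (hx₀ : ∀ᵐ ω ∂P, X 0 ω = x₀) {f : E → ℝ} (hf : UnitVariation R f) (t : ℝ≥0) :
    Integrable (fun ω => f (X t ω)) P ∧ ∀ θ : ℝ, |θ| ≤ 1 →
      Integrable (fun ω => Real.exp (θ * (f (X t ω) - ∫ ω', f (X t ω') ∂P))) P ∧
      ∫ ω, Real.exp (θ * (f (X t ω) - ∫ ω', f (X t ω') ∂P)) ∂P
        ≤ Real.exp ((∑ i, w i) * θ ^ 2 * t) := by
  have hm : ∀ g : E → ℝ, Measurable fun ω => g (X t ω) := fun g =>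
    (Measurable.of_discrete (f := g)).comp (hX t)
  have hcl : ∀ k, Integrable (fun ω => clampBCF f k (X t ω)) P := fun k =>
    integrable_boundedContinuousFunction_comp P (hX t) _
  have habs : Integrable (fun ω => |f (X t ω)|) P := by
    refine (integrable_and_integral_le_of_tendsto (Y := fun k ω => |clampBCF f k (X t ω)|)
      (C := |f x₀| + (∑ i, w i) * t) (fun k => (hcl k).abs)
      (fun k => hm fun x => |clampBCF f k x|) (hm fun x => |f x|) (fun _ _ => abs_nonneg _)
      (fun k => ?_) fun ω => (tendsto_clampBCF f _).abs).1
    let g : E →ᵇ ℝ := BoundedContinuousFunction.ofNormedAddCommGroupDiscrete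
      (fun x => |clampBCF f k x|) ‖clampBCF f k‖ fun x => by
        rw [Real.norm_eq_abs, abs_abs]; exact (clampBCF f k).norm_coe_le_norm x
    have hg : UnitVariation R g := (hf.clamp k).abs
    have := integral_boundedContinuousFunction_le hw hR hX hμ hx₀ hg t
    refine this.trans (add_le_add_left ?_ _)
    exact abs_clampBCF_le f k x₀
  have hint : Integrable (fun ω => f (X t ω)) P :=
    (integrable_norm_iff (hm f).aestronglyMeasurable).1 habs
  refine ⟨hint, fun θ hθ => ?_⟩
  have hmean : Tendsto (fun k => ∫ ω, clampBCF f k (X t ω) ∂P) atTop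
      (𝓝 (∫ ω, f (X t ω) ∂P)) :=
    tendsto_integral_of_dominated_convergence _ (fun k => (hcl k).aestronglyMeasurable) habs
      (fun k => ae_of_all _ fun ω => abs_clampBCF_le f k _)
      (ae_of_all _ fun ω => tendsto_clampBCF f _)
  refine integrable_and_integral_le_of_tendsto
    (Y := fun k ω => Real.exp (θ * (clampBCF f k (X t ω) - ∫ ω', clampBCF f k (X t ω') ∂P)))
    (fun k => ?_) (fun k => hm fun x => Real.exp (θ * (clampBCF f k x - _)))
    (hm fun x => Real.exp (θ * (f x - _))) (fun _ _ => (Real.exp_pos _).le)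
    (fun k => integral_exp_boundedContinuousFunction_le hw hT hR hX hμ hx₀ (hf.clamp k) t hθ)
    fun ω => (Real.continuous_exp.tendsto _).comp
      (((tendsto_clampBCF f _).sub hmean).const_mul θ)
  have := (integrable_boundedContinuousFunction_comp P (hX t)
    (NormedSpace.exp (θ • clampBCF f k))).div_const
      (Real.exp (θ * ∫ ω', clampBCF f k (X t ω') ∂P))
  refine this.congr (ae_of_all _ fun ω => ?_)
  simp only [boundedContinuousFunction_exp_apply, BoundedContinuousFunction.smul_apply,
    smul_eq_mul, mul_sub, Real.exp_sub]

/-- Two-sided Chernoff bound for functions of unit variation. -/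
lemma UnitVariation.measureReal_abs_sub_integral_ge_le (hw : ∀ i, 0 ≤ w i)
    (hT : ∀ i x y, R x y → R (T i x) (T i y))
    (hR : ∀ i x, R (T i x) x ∨ R x (T i x)) (hX : ∀ t, Measurable (X t))
    (hμ : SolvesForward (jumpGenerator w T) fun s => lawCLM P (hX s.toNNReal)) {x₀ : E}
    (hx₀ : ∀ᵐ ω ∂P, X 0 ω = x₀) {f : E → ℝ} (hf : UnitVariation R f) (t : ℝ≥0) (u : ℝ) {θ : ℝ}
    (hθ0 : 0 ≤ θ) (hθ1 : θ ≤ 1) :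
    P.real {ω | u ≤ |f (X t ω) - ∫ ω', f (X t ω') ∂P|}
      ≤ 2 * Real.exp ((∑ i, w i) * θ ^ 2 * t - θ * u) := by
  set a := ∫ ω', f (X t ω') ∂P with ha
  obtain ⟨-, h⟩ := hf.integrable_and_integral_exp_le hw hT hR hX hμ hx₀ t
  rw [← ha] at h
  have key : ∀ ε : ℝ, |ε| = 1 → P.real {ω | u ≤ ε * (f (X t ω) - a)}
      ≤ Real.exp ((∑ i, w i) * θ ^ 2 * t - θ * u) := fun ε hε => by
    have e : ∀ ω, θ * (ε * (f (X t ω) - a)) = θ * ε * (f (X t ω) - a) := fun ω => by ring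
    have hs : (θ * ε) ^ 2 = θ ^ 2 := by rw [mul_pow, ← sq_abs ε, hε]; ring
    obtain ⟨h1, h2⟩ := h (θ * ε) (by rw [abs_mul, hε, mul_one, abs_of_nonneg hθ0]; exact hθ1)
    have h3 := measure_ge_le_exp_mul_mgf (μ := P) (X := fun ω => ε * (f (X t ω) - a)) u hθ0
      (by simpa only [e] using h1)
    refine h3.trans ?_
    rw [mgf, sub_eq_neg_add, Real.exp_add, ← neg_mul]
    refine mul_le_mul_of_nonneg_left ?_ (Real.exp_pos _).le
    simp only [e]
    rwa [hs] at h2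
  calc P.real {ω | u ≤ |f (X t ω) - a|}
      ≤ P.real ({ω | u ≤ 1 * (f (X t ω) - a)} ∪ {ω | u ≤ -1 * (f (X t ω) - a)}) := by
        refine measureReal_mono fun ω hω => ?_
        have hω' : u ≤ |f (X t ω) - a| := hω
        rcases le_abs.1 hω' with h | h
        · exact Or.inl (by rwa [Set.mem_ofPred_eq, one_mul])
        · exact Or.inr (by rwa [Set.mem_ofPred_eq, neg_one_mul])
    _ ≤ _ := measureReal_union_le _ _
    _ ≤ _ := by
        have h1 := key 1 (by simp)
        have h2 := key (-1) (by simp)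
        linarith

end Concentration

/-! ### The supermarket model -/

section Supermarket

variable {n d : ℕ}

/-- `y` is `x`, possibly with one more customer in one queue. -/
def AddsAtMostOne (x y : Fin n → ℕ) : Prop :=
  x = y ∨ ∃ k, y = Function.update x k (x k + 1)

lemma addsAtMostOne_arrive (x : Fin n → ℕ) (δ : Fin d → Fin n) :
    AddsAtMostOne x (supermarketArrive x δ) := by
  unfold supermarketArrive
  split
  · exact Or.inr ⟨_, rfl⟩
  · exact Or.inl rfl

lemma addsAtMostOne_depart (x : Fin n → ℕ) (j : Fin n) :
    AddsAtMostOne (supermarketDepart x j) x := by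
  unfold supermarketDepart
  rcases Nat.eq_zero_or_pos (x j) with h | h
  · left
    rw [h, Nat.zero_sub, ← h, Function.update_eq_self]
  · right
    refine ⟨j, ?_⟩
    rw [Function.update_self, Function.update_idem, Nat.sub_add_cancel h,
      Function.update_eq_self]

lemma argmin_update_add_one {x : Fin n → ℕ} {k j j' : Fin n} {l : List (Fin n)}
    (hj : l.argmin x = some j) (hj' : l.argmin (Function.update x k (x k + 1)) = some j')
    (hk : j ≠ k) : j = j' := by
  rw [List.argmin_eq_some_iff] at hj hj'
  have hle : ∀ i, x i ≤ Function.update x k (x k + 1) i := fun i => by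
    rcases eq_or_ne i k with rfl | h
    · rw [Function.update_self]; exact Nat.le_succ _
    · rw [Function.update_of_ne h]
  have h1 := hj'.2.1 j hj.1
  have h2 := hj.2.1 j' hj'.1
  have h3 := hle j'
  have h4 : Function.update x k (x k + 1) j = x j := Function.update_of_ne hk _ _
  have h5 := hj.2.2 j' hj'.1 (by omega)
  have h6 := hj'.2.2 j hj.1 (by omega)
  exact (List.idxOf_inj hj.1).1 (le_antisymm h5 h6)

lemma AddsAtMostOne.arrive {x y : Fin n → ℕ} (h : AddsAtMostOne x y) (δ : Fin d → Fin n) :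
    AddsAtMostOne (supermarketArrive x δ) (supermarketArrive y δ) := by
  rcases h with rfl | ⟨k, rfl⟩
  · exact Or.inl rfl
  set y := Function.update x k (x k + 1) with hy
  rcases hx : (List.ofFn δ).argmin x with _ | j
  · have hy' : (List.ofFn δ).argmin y = none := by
      rw [List.argmin_eq_none] at hx ⊢
      exact hx
    simp only [supermarketArrive, hx, hy']
    exact Or.inr ⟨k, rfl⟩
  rcases hy' : (List.ofFn δ).argmin y with _ | j'
  · rw [List.argmin_eq_none] at hy'
    rw [hy'] at hx
    simp at hx
  simp only [supermarketArrive, hx, hy']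
  right
  rcases eq_or_ne j k with rfl | hk
  · exact ⟨j', rfl⟩
  · obtain rfl := argmin_update_add_one hx hy' hk
    refine ⟨k, ?_⟩
    rw [hy, Function.update_of_ne hk, Function.update_of_ne hk.symm, Function.update_comm hk]

lemma AddsAtMostOne.depart {x y : Fin n → ℕ} (h : AddsAtMostOne x y) (j : Fin n) :
    AddsAtMostOne (supermarketDepart x j) (supermarketDepart y j) := by
  rcases h with rfl | ⟨k, rfl⟩
  · exact Or.inl rfl
  rcases eq_or_ne j k with rfl | hk
  · have : supermarketDepart (Function.update x j (x j + 1)) j = x := by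
      rw [supermarketDepart, Function.update_self, Function.update_idem, Nat.add_sub_cancel,
        Function.update_eq_self]
    rw [this]
    exact addsAtMostOne_depart x j
  · refine Or.inr ⟨k, ?_⟩
    rw [supermarketDepart, supermarketDepart, Function.update_of_ne hk,
      Function.update_of_ne hk.symm, Function.update_comm hk]

lemma IsL1Lipschitz.unitVariation {f : (Fin n → ℕ) → ℝ} (hf : IsL1Lipschitz f) :
    UnitVariation AddsAtMostOne f := by
  rintro x y (rfl | ⟨k, rfl⟩)
  · simp
  · refine (hf _ _).trans_eq ?_
    rw [Finset.sum_eq_single k (fun j _ hj => by rw [Function.update_of_ne hj]; simp)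
      (fun h => absurd (Finset.mem_univ k) h)]
    simp

/-- The rates of the arrival and departure events. -/
noncomputable def supermarketRate (n d : ℕ) (lam : ℝ) : (Fin d → Fin n) ⊕ Fin n → ℝ :=
  Sum.elim (fun _ => lam * n / (n : ℝ) ^ d) fun _ => 1

/-- The effects of the arrival and departure events. -/
def supermarketJump (n d : ℕ) : (Fin d → Fin n) ⊕ Fin n → (Fin n → ℕ) → Fin n → ℕ :=
  Sum.elim (fun δ x => supermarketArrive x δ) fun j x => supermarketDepart x j

lemma sum_supermarketRate (hn : n ≠ 0) (lam : ℝ) :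
    ∑ i, supermarketRate n d lam i = lam * n + n := by
  have : (n : ℝ) ≠ 0 := Nat.cast_ne_zero.2 hn
  simp only [supermarketRate, Fintype.sum_sum_type, Sum.elim_inl, Sum.elim_inr, Finset.sum_const,
    Finset.card_univ, Fintype.card_fun, Fintype.card_fin, nsmul_eq_mul, Nat.cast_pow, mul_one]
  field_simp

lemma jumpGenerator_supermarket (hn : n ≠ 0) (lam : ℝ) (φ : (Fin n → ℕ) →ᵇ ℝ) (x : Fin n → ℕ) :
    jumpGenerator (supermarketRate n d lam) (supermarketJump n d) φ x
      = supermarketGenerator lam d φ x := by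
  have : (n : ℝ) ≠ 0 := Nat.cast_ne_zero.2 hn
  rw [jumpGenerator_apply, Fintype.sum_sum_type, supermarketGenerator]
  simp only [supermarketRate, supermarketJump, Sum.elim_inl, Sum.elim_inr, ← Finset.mul_sum]
  field_simp

lemma IsQueueLengthsProcess.solvesForward (hn : n ≠ 0) {lam : ℝ} {Ω : Type*}
    {m : MeasurableSpace Ω} {P : Measure Ω} [IsProbabilityMeasure P] {ℱ : Filtration ℝ≥0 m}
    {X : ℝ≥0 → Ω → (Fin n → ℕ)} (hX : IsQueueLengthsProcess lam d P ℱ X)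
    (hm : ∀ t, Measurable (X t)) :
    SolvesForward (jumpGenerator (supermarketRate n d lam) (supermarketJump n d))
      fun s => lawCLM P (hm s.toNNReal) := by
  refine solvesForward_lawCLM (ℱ := ℱ) hm hX.rightContinuous fun φ => ?_
  simp only [jumpGenerator_supermarket hn]
  exact hX.martingale φ ⟨‖φ‖, fun x => φ.norm_coe_le_norm x⟩

end Supermarket

lemma chernoff_exponent_le {lam n t u : ℝ} (hlam : lam ≤ 1) (hn : 0 < n) (ht : 0 < t)
    (hu : 0 ≤ u) :
    (lam * n + n) * (u / (4 * (n * t + u))) ^ 2 * t - u / (4 * (n * t + u)) * u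
      ≤ -(1 / 8 * u ^ 2 / (n * t + u)) := by
  have hs : 0 < n * t + u := by positivity
  have h1 : (lam * n + n) * t ≤ 2 * (n * t + u) := by nlinarith [mul_pos hn ht]
  have h2 : (lam * n + n) * (u / (4 * (n * t + u))) ^ 2 * t
      ≤ 2 * (n * t + u) * (u / (4 * (n * t + u))) ^ 2 := by
    rw [mul_right_comm]
    exact mul_le_mul_of_nonneg_right h1 (sq_nonneg _)
  have h3 : 2 * (n * t + u) * (u / (4 * (n * t + u))) ^ 2 - u / (4 * (n * t + u)) * u
      = -(1 / 8 * u ^ 2 / (n * t + u)) := by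
    field_simp
    ring
  linarith

theorem lemma4p3 (lam : ℝ) (hlam : 0 < lam ∧ lam < 1) (d : ℕ) (hd : 1 ≤ d) :
    ∃ c : ℝ, 0 < c ∧
      ∀ (n : ℕ), 2 ≤ n →
      ∀ (Ω : Type*) (m : MeasurableSpace Ω) (P : Measure Ω) (_ : IsProbabilityMeasure P)
        (ℱ : Filtration ℝ≥0 m) (X : ℝ≥0 → Ω → (Fin n → ℕ)),
      IsQueueLengthsProcess lam d P ℱ X →
      ∀ (x₀ : Fin n → ℕ), (∀ᵐ ω ∂P, X 0 ω = x₀) →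
      ∀ (f : (Fin n → ℕ) → ℝ), IsL1Lipschitz f →
      ∀ (t : ℝ≥0), 0 < t →
        Integrable (fun ω => f (X t ω)) P ∧
        ∀ (u : ℝ), 0 ≤ u →
          P.real {ω | u ≤ |f (X t ω) - ∫ ω', f (X t ω') ∂P|}
            ≤ n * Real.exp (-(c * u ^ 2 / (n * t + u))) := by
  refine ⟨1 / 8, by norm_num, fun n hn Ω m P _ ℱ X hX x₀ hx₀ f hf t ht => ?_⟩
  have hn0 : n ≠ 0 := by omega
  have hm : ∀ t, Measurable (X t) := fun t => (hX.adapted t).mono (ℱ.le t) le_rfl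
  have hμ := hX.solvesForward hn0 hm
  have hw : ∀ i, 0 ≤ supermarketRate n d lam i := by
    have := hlam.1
    rintro (i | i)
    · exact div_nonneg (by positivity) (by positivity)
    · exact zero_le_one
  have hT : ∀ i x y, AddsAtMostOne x y →
      AddsAtMostOne (supermarketJump n d i x) (supermarketJump n d i y) := by
    rintro (δ | j) x y h
    · exact h.arrive δ
    · exact h.depart j
  have hR : ∀ i x, AddsAtMostOne (supermarketJump n d i x) x ∨
      AddsAtMostOne x (supermarketJump n d i x) := by
    rintro (δ | j) x
    · exact Or.inr (addsAtMostOne_arrive x δ)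
    · exact Or.inl (addsAtMostOne_depart x j)
  refine ⟨(hf.unitVariation.integrable_and_integral_exp_le hw hT hR hm hμ hx₀ t).1,
    fun u hu => ?_⟩
  have hn' : (2 : ℝ) ≤ n := by exact_mod_cast hn
  have ht' : (0 : ℝ) < t := ht
  have hs : 0 < n * (t : ℝ) + u := by positivity
  have hb := hf.unitVariation.measureReal_abs_sub_integral_ge_le hw hT hR hm hμ hx₀ t u
    (θ := u / (4 * (n * t + u))) (by positivity) (by
      rw [div_le_one (by positivity)]
      nlinarith [mul_pos (by linarith : (0 : ℝ) < n) ht'])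
  rw [sum_supermarketRate hn0] at hb
  refine hb.trans (mul_le_mul hn' (Real.exp_le_exp.2 ?_) (Real.exp_pos _).le (by linarith))
  exact chernoff_exponent_le hlam.2.le (by linarith) ht' hu
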